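/- Let $G=(V,E)$ be a finite, connected, undirected simple graph with $n=|V|$ nodes and minimum degree $\delta(G)$, and let $k$ be an integer with $1\le k\le n$. Amnesiac flooding on $G$ started by a set $S\subseteq V$ proceeds in synchronous rounds: in round $1$ every node of $S$ sends a message to all its neighbours; in every later round, each node that received at least one message sent in the preceding round sends the message to exactly those of its neighbours from which it did not just receive it. Let $\mathrm{Flood}_G(S)$ be the number of rounds until termination, i.e. the least $t\ge 0$ such that no message is sent after round $t$, and let $\mathrm{Flood}_k(G)=\min\{\mathrm{Flood}_G(S) : S\subseteq V,\ |S|=k\}$. For nonempty $U\subseteq V$ let $d_G(U)=\max_{v\in V}\min_{u\in U} d_G(v,u)$, where $d_G(v,u)$ is the distance in $G$. Let $r_k(G)=\min\{d_G(U): U\subseteq V,\ |U|=k\}$, and let $r^{ni}_k(G)$ be the minimum of $d_G(U)$ over those $U\subseteq V$ with $|U|=k$ for which the induced subgraph $G[U]$ has no isolated node (the minimum over an empty family is $\infty$). Then: 1. If $k>1$, then $r_k(G)\le \mathrm{Flood}_k(G)\le r^{ni}_k(G)+1\le r_{\lfloor k/2\rfloor}(G)+1$. 2. If $n\ge 2$,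 then $\mathrm{Flood}_k(G)=1$ if and only if $n=k$, or $G$ is bipartite with bipartition $V=V_1\cup V_2$ such that $|V_1|=k$ or $|V_2|=k$. 3. $\mathrm{Flood}_k(G)\le 2$ if $k\ge 2n/3$, or if $\delta(G)\ge 3$ and $k\ge n/2$. 4. $\mathrm{Flood}_k(G)\le 3$ if $k\ge n/2$. -/

import Mathlib

namespace AmnesiacFlooding

variable {V : Type*}

/-- `Sends G S i v u`: in round `i` of amnesiac flooding on `G`, started concurrently by all nodes
of `S`, node `v` sends the message to node `u`. Rounds are numbered from `1`. In round `1` every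
node of `S` sends to all its neighbours. In every later round a node that has received at least
one message (sent in the preceding round) sends to precisely those neighbours from which it has
not just received it. -/
def Sends (G : SimpleGraph V) (S : Set V) : ℕ → V → V → Prop
  | 0 => fun _ _ => False
  | 1 => fun v u => v ∈ S ∧ G.Adj v u
  | i + 2 => fun v u =>
      G.Adj v u ∧ (∃ w, Sends G S (i + 1) w v) ∧ ¬ Sends G S (i + 1) u v

/-- The number of rounds until amnesiac flooding on `G` started by `S` terminates: the least `t`
such that no message is sent after round `t` (`⊤` if there is no such `t`). -/
noncomputable def floodTime (G : SimpleGraph V) (S : Set V) : ℕ∞ :=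
  ⨅ (t : ℕ) (_ : ∀ i, t < i → ∀ v u, ¬ Sends G S i v u), (t : ℕ∞)

/-- `Flood_k(G)`: the minimum of `floodTime G S` over all node sets `S` of size `k`. -/
noncomputable def flood (G : SimpleGraph V) (k : ℕ) : ℕ∞ :=
  ⨅ (S : Finset V) (_ : S.card = k), floodTime G (S : Set V)

/-- `d_G(U)`: the maximum over all nodes `v` of the distance from `v` to the set `U`. -/
noncomputable def coverRadius (G : SimpleGraph V) (U : Set V) : ℕ∞ :=
  ⨆ v : V, ⨅ u ∈ U, G.edist v u

/-- The `k`-radius `r_k(G)`. -/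
noncomputable def kRadius (G : SimpleGraph V) (k : ℕ) : ℕ∞ :=
  ⨅ (U : Finset V) (_ : U.card = k), coverRadius G (U : Set V)

/-- The subgraph of `G` induced by `U` contains no isolated node. -/
def NoIsolated (G : SimpleGraph V) (U : Set V) : Prop :=
  ∀ u : U, ∃ w : U, (G.induce U).Adj u w

/-- The non-isolated `k`-radius `r^{ni}_k(G)`. -/
noncomputable def niRadius (G : SimpleGraph V) (k : ℕ) : ℕ∞ :=
  ⨅ (U : Finset V) (_ : U.card = k ∧ NoIsolated G (U : Set V)), coverRadius G (U : Set V)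

end AmnesiacFlooding

namespace AmnesiacFlooding

variable {V : Type*}

/-! Flooding is governed by the sets `reach G S j`: in round `i + 2` node `v` sends to its neighbour
`u` exactly when `v` ends a walk of length `i + 1` from `S` and `u` ends none of length `i`
(`sends_add_two_iff`). Hence flooding stops by round `t + 1` iff `reach G S (t + 2) ⊆ reach G S t`,
and every claim becomes one about walks.

For 1, each node must be reached before this stationarity sets in. If `S` induces no isolated node,
the sets increase and fill `V` after `coverRadius G S` steps; doubling a set by neighbours removes
isolated nodes. For 2, `t = 0` says that `S` is closed under walks of length two.

For 3, a total dominating set gives `reach G S 1 = V`, hence two rounds. Total dominating sets of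
size at most `n/2` come from a transversal bound for 3-uniform hypergraphs, and of size at most
`2n/3` from a charging argument on an extremal set. For 4, Ore's domination bound is applied to the
relation "joined by a walk of length two", giving `reach G S 2 = V`. -/

/-! ### Rounds of flooding as walks -/

/-- The endpoints of the walks of length `j` that start in `S`. -/
def reach (G : SimpleGraph V) (S : Set V) : ℕ → Set V
  | 0 => S
  | j + 1 => {v | ∃ w ∈ reach G S j, G.Adj w v}

/-- A node outside `reach G S i` hears in round `i + 2` from all its neighbours in `reach G S (i +
1)`, so memory of one round suffices to describe all rounds. -/
theorem sends_add_two_iff (G : SimpleGraph V) (S : Set V) (i : ℕ) (v u : V) :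
    Sends G S (i + 2) v u ↔ G.Adj v u ∧ v ∈ reach G S (i + 1) ∧ u ∉ reach G S i := by
  induction i generalizing v u with
  | zero =>
    simp only [Sends, reach, Set.mem_ofPred_eq]
    constructor
    · rintro ⟨h, hw, hn⟩
      exact ⟨h, hw, fun hu => hn ⟨hu, h.symm⟩⟩
    · rintro ⟨h, hw, hn⟩
      exact ⟨h, hw, fun hu => hn hu.1⟩
  | succ i ih =>
    have hstep : Sends G S (i + 1 + 2) v u ↔
        G.Adj v u ∧ (∃ w, Sends G S (i + 2) w v) ∧ ¬ Sends G S (i + 2) u v := Iff.rfl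
    rw [hstep]
    simp only [ih]
    constructor
    · rintro ⟨h, ⟨w, hwv, hw, hv⟩, hn⟩
      exact ⟨h, ⟨w, hw, hwv⟩, fun hu => hn ⟨h.symm, hu, hv⟩⟩
    -- Here `v ∉ reach G S i`, since otherwise its neighbour `u` would lie in `reach G S (i + 1)`.
    · rintro ⟨h, ⟨w, hw, hwv⟩, hu⟩
      exact ⟨h, ⟨w, hwv, hw, fun hv => hu ⟨v, hv, h⟩⟩, fun hn => hu hn.2.1⟩

theorem reach_add_two_subset {G : SimpleGraph V} {S : Set V} {t : ℕ}
    (h : reach G S (t + 2) ⊆ reach G S t) {i : ℕ} (hi : t ≤ i) :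
    reach G S (i + 2) ⊆ reach G S i := by
  induction i, hi using Nat.le_induction with
  | base => exact h
  | succ i _ ih =>
    rintro v ⟨w, hw, hwv⟩
    exact ⟨w, ih hw, hwv⟩

theorem floodTime_le_iff (G : SimpleGraph V) (S : Set V) (t : ℕ) :
    floodTime G S ≤ t ↔ ∀ i, t < i → ∀ v u, ¬ Sends G S i v u := by
  constructor
  · intro h
    have h' : floodTime G S < ((t + 1 : ℕ) : ℕ∞) :=
      lt_of_le_of_lt h (by exact_mod_cast Nat.lt_succ_self t)
    simp only [floodTime, iInf_lt_iff] at h'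
    obtain ⟨t', ht', hlt⟩ := h'
    have : t' < t + 1 := by exact_mod_cast hlt
    exact fun i hi => ht' i (by omega)
  · intro h
    exact iInf₂_le t h

/-- Silence in round `t + 2` is this inclusion, and the inclusion persists for all larger indices.
-/
theorem floodTime_le_succ_iff (G : SimpleGraph V) (S : Set V) (t : ℕ) :
    floodTime G S ≤ ((t + 1 : ℕ) : ℕ∞) ↔ reach G S (t + 2) ⊆ reach G S t := by
  rw [floodTime_le_iff]
  constructor
  · rintro h u ⟨v, hv, hvu⟩
    by_contra hu
    exact h (t + 2) (by omega) v u ((sends_add_two_iff G S t v u).2 ⟨hvu, hv, hu⟩)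
  · intro h i hi v u hs
    obtain ⟨j, rfl⟩ : ∃ j, i = j + 2 := ⟨i - 2, by omega⟩
    obtain ⟨hvu, hv, hu⟩ := (sends_add_two_iff G S j v u).1 hs
    exact hu (reach_add_two_subset h (by omega) ⟨v, hv, hvu⟩)

theorem floodTime_le_zero_iff (G : SimpleGraph V) (S : Set V) :
    floodTime G S ≤ 0 ↔ reach G S 1 = ∅ := by
  have h0 := floodTime_le_iff G S 0
  rw [Nat.cast_zero] at h0
  rw [h0, Set.eq_empty_iff_forall_notMem]
  constructor
  · rintro h u ⟨v, hv, hvu⟩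
    exact h 1 one_pos v u ⟨hv, hvu⟩
  · intro h i hi v u hs
    match i, hi, hs with
    | 1, _, hs => exact h u ⟨v, hs⟩
    | j + 2, _, hs =>
      obtain ⟨-, hv, -⟩ := (sends_add_two_iff G S j v u).1 hs
      have hempty : ∀ j v, v ∉ reach G S (j + 1) := by
        intro j
        induction j with
        | zero => exact h
        | succ j ih => rintro v ⟨w, hw, -⟩; exact ih w hw
      exact hempty j v hv

theorem flood_le_iff (G : SimpleGraph V) (k t : ℕ) :
    flood G k ≤ t ↔ ∃ S : Finset V, S.card = k ∧ floodTime G (S : Set V) ≤ t := by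
  constructor
  · intro h
    have h' : flood G k < ((t + 1 : ℕ) : ℕ∞) :=
      lt_of_le_of_lt h (by exact_mod_cast Nat.lt_succ_self t)
    simp only [flood, iInf_lt_iff] at h'
    obtain ⟨S, hS, hlt⟩ := h'
    refine ⟨S, hS, ?_⟩
    rw [Nat.cast_add, Nat.cast_one] at hlt
    exact Order.le_of_lt_add_one hlt
  · rintro ⟨S, hS, h⟩
    exact (iInf₂_le S hS).trans h

/-! ### Flooding time and covering radius -/

theorem mem_reach_of_walk {G : SimpleGraph V} {S : Set V} {s v : V} (p : G.Walk v s)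
    (hs : s ∈ S) : v ∈ reach G S p.length := by
  induction p with
  | nil => exact hs
  | cons h p ih => exact ⟨_, ih hs, h.symm⟩

theorem exists_edist_le_of_mem_reach {G : SimpleGraph V} {S : Set V} {j : ℕ} {v : V}
    (h : v ∈ reach G S j) : ∃ s ∈ S, G.edist v s ≤ j := by
  induction j generalizing v with
  | zero => exact ⟨v, h, by simp⟩
  | succ j ih =>
    obtain ⟨w, hw, hwv⟩ := h
    obtain ⟨s, hs, hd⟩ := ih hw
    refine ⟨s, hs, (SimpleGraph.edist_triangle (v := w)).trans ?_⟩
    rw [SimpleGraph.edist_eq_one_iff_adj.2 hwv.symm, add_comm]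
    push_cast
    gcongr

theorem coverRadius_le_floodTime {G : SimpleGraph V} (hG : G.Connected) {S : Set V}
    (hS : S.Nonempty) : coverRadius G S ≤ floodTime G S := by
  classical
  obtain ⟨s, hs⟩ := hS
  refine iSup_le fun v => ?_
  generalize hT : floodTime G S = T
  induction T with
  | top => exact le_top
  | coe t =>
    have hex : ∃ m, v ∈ reach G S m := by
      obtain ⟨p⟩ := hG.preconnected v s
      exact ⟨_, mem_reach_of_walk p hs⟩
    have hm := Nat.find_spec hex
    have hmin := fun j => @Nat.find_min _ _ hex j
    set m := Nat.find hex
    -- If the first index `m` at which `v` is reached exceeded `t`, stationarity would already put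
    -- `v` in the set with index `m - 2`.
    have hmt : m ≤ t := by
      by_contra hlt
      push Not at hlt
      rcases t with _ | t
      · have h1 := (floodTime_le_zero_iff G S).1 hT.le
        have hempty : ∀ j, reach G S (j + 1) = ∅ := by
          intro j
          induction j with
          | zero => exact h1
          | succ j ih =>
            refine Set.eq_empty_iff_forall_notMem.2 ?_
            rintro u ⟨w, hw, -⟩
            rw [ih] at hw
            exact hw
        obtain ⟨j, hj⟩ : ∃ j, m = j + 1 := ⟨m - 1, by omega⟩
        rw [hj, hempty] at hm
        exact hm
      · have h1 := (floodTime_le_succ_iff G S t).1 hT.le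
        obtain ⟨j, hj⟩ : ∃ j, m = j + 2 := ⟨m - 2, by omega⟩
        rw [hj] at hm
        exact hmin j (by omega) (reach_add_two_subset h1 (by omega) hm)
    obtain ⟨u, hu, hd⟩ := exists_edist_le_of_mem_reach hm
    exact (iInf₂_le u hu).trans (hd.trans (by exact_mod_cast hmt))

theorem coverRadius_anti (G : SimpleGraph V) {S T : Set V} (h : S ⊆ T) :
    coverRadius G T ≤ coverRadius G S :=
  iSup_mono fun _ => biInf_mono h

/-- A walk from `S` can be prolonged by one step at its start inside `S`, so the sets `reach G S j`
increase with `j`. -/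
theorem floodTime_le_coverRadius_add_one {G : SimpleGraph V} {S : Set V}
    (hS : NoIsolated G S) : floodTime G S ≤ coverRadius G S + 1 := by
  generalize hT : coverRadius G S = T
  induction T with
  | top => simp
  | coe d =>
    have hmono : ∀ j, reach G S j ⊆ reach G S (j + 1) := by
      intro j
      induction j with
      | zero =>
        intro v hv
        obtain ⟨w, hw⟩ := hS ⟨v, hv⟩
        exact ⟨w, w.2, (SimpleGraph.comap_adj.1 hw).symm⟩
      | succ j ih =>
        rintro v ⟨w, hw, hwv⟩
        exact ⟨w, ih hw, hwv⟩
    have hall : ∀ v, v ∈ reach G S d := by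
      intro v
      have hv : ⨅ u ∈ S, G.edist v u ≤ d := hT ▸ le_iSup (fun v => ⨅ u ∈ S, G.edist v u) v
      have hlt : ⨅ u ∈ S, G.edist v u < ((d + 1 : ℕ) : ℕ∞) :=
        lt_of_le_of_lt hv (by exact_mod_cast Nat.lt_succ_self d)
      simp only [iInf_lt_iff] at hlt
      obtain ⟨u, hu, hlt⟩ := hlt
      obtain ⟨p, hp⟩ := SimpleGraph.exists_walk_of_edist_ne_top hlt.ne_top
      rw [← hp] at hlt
      have hle : p.length < d + 1 := by exact_mod_cast hlt
      exact monotone_nat_of_le_succ hmono (Nat.lt_succ_iff.1 hle) (mem_reach_of_walk p hu)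
    exact_mod_cast (floodTime_le_succ_iff G S d).2 fun v _ => hall v

theorem noIsolated_iff (G : SimpleGraph V) (U : Set V) :
    NoIsolated G U ↔ ∀ u ∈ U, ∃ w ∈ U, G.Adj u w := by
  simp [NoIsolated]

/-- In a connected graph, a nonempty proper vertex set has a neighbour outside. -/
theorem exists_adj_notMem {G : SimpleGraph V} (hG : G.Connected) {U : Set V}
    (hU : U.Nonempty) (hne : U ≠ Set.univ) : ∃ u ∈ U, ∃ w ∉ U, G.Adj u w := by
  obtain ⟨s, hs⟩ := hU
  obtain ⟨t, ht⟩ := (Set.ne_univ_iff_exists_notMem U).1 hne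
  by_contra! hcon
  obtain ⟨p⟩ := hG.preconnected s t
  clear hne
  induction p with
  | nil => exact ht hs
  | cons h p ih =>
    refine ih ?_ ht
    by_contra hn
    exact hcon _ hs _ hn h

theorem exists_adj {G : SimpleGraph V} [Fintype V] (hG : G.Connected)
    (hn : 2 ≤ Fintype.card V) (v : V) : ∃ w, G.Adj v w := by
  have : Nontrivial V := Fintype.one_lt_card_iff_nontrivial.1 hn
  exact hG.preconnected.exists_adj_of_nontrivial v

/-- Adding one neighbour per node of `U` gives at most `2 * (k / 2) ≤ k` nodes; connectivity then
allows growth by one boundary node at a time. -/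
theorem exists_noIsolated_superset [Fintype V] {G : SimpleGraph V} (hG : G.Connected)
    {k : ℕ} (hk : 1 < k) (hkn : k ≤ Fintype.card V) (U : Finset V) (hU : U.card = k / 2) :
    ∃ S : Finset V, U ⊆ S ∧ S.card = k ∧ NoIsolated G (S : Set V) := by
  classical
  choose g hg using exists_adj hG (hk.trans_le hkn)
  have key : ∀ m, (U ∪ U.image g).card ≤ m → m ≤ Fintype.card V →
      ∃ S : Finset V, U ⊆ S ∧ S.card = m ∧ NoIsolated G (S : Set V) := by
    intro m hm
    induction m, hm using Nat.le_induction with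
    | base =>
      refine fun _ => ⟨U ∪ U.image g, Finset.subset_union_left, rfl, ?_⟩
      rw [noIsolated_iff]
      intro u hu
      simp only [Finset.coe_union, Finset.coe_image, Set.mem_union, Finset.mem_coe,
        Set.mem_image] at hu ⊢
      rcases hu with hu | ⟨w, hw, rfl⟩
      · exact ⟨g u, Or.inr ⟨u, hu, rfl⟩, hg u⟩
      · exact ⟨w, Or.inl hw, (hg w).symm⟩
    | succ m _ ih =>
      intro hlt
      obtain ⟨S, hUS, hSm, hS⟩ := ih (by omega)
      have hSne : (S : Set V).Nonempty := by
        rw [Finset.coe_nonempty]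
        exact (Finset.card_pos.1 (by omega : 0 < U.card)).mono hUS
      have hSuniv : (S : Set V) ≠ Set.univ := by
        intro h
        rw [Finset.coe_eq_univ.1 h, Finset.card_univ] at hSm
        omega
      obtain ⟨u, hu, w, hw, huw⟩ := exists_adj_notMem hG hSne hSuniv
      refine ⟨insert w S, hUS.trans (Finset.subset_insert _ _), ?_, ?_⟩
      · rw [Finset.card_insert_of_notMem hw, hSm]
      · rw [noIsolated_iff] at hS ⊢
        intro x hx
        rw [Finset.coe_insert] at hx ⊢
        rcases hx with rfl | hx
        · exact ⟨u, Or.inr hu, huw.symm⟩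
        · obtain ⟨y, hy, hxy⟩ := hS x hx
          exact ⟨y, Or.inr hy, hxy⟩
  refine key k ?_ hkn
  have h1 := Finset.card_union_le U (U.image g)
  have h2 := Finset.card_image_le (s := U) (f := g)
  omega

theorem kRadius_le_flood {G : SimpleGraph V} (hG : G.Connected) {k : ℕ} (hk : 1 ≤ k) :
    kRadius G k ≤ flood G k := by
  refine le_iInf₂ fun S hS => (iInf₂_le S hS).trans (coverRadius_le_floodTime hG ?_)
  exact Finset.coe_nonempty.2 (Finset.card_pos.1 (by omega))

theorem flood_le_niRadius_add_one (G : SimpleGraph V) (k : ℕ) :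
    flood G k ≤ niRadius G k + 1 := by
  simp only [niRadius, ENat.iInf_add]
  exact le_iInf₂ fun S hS => (iInf₂_le S hS.1).trans (floodTime_le_coverRadius_add_one hS.2)

theorem niRadius_le_kRadius_half [Fintype V] {G : SimpleGraph V} (hG : G.Connected) {k : ℕ}
    (hk : 1 < k) (hkn : k ≤ Fintype.card V) : niRadius G k ≤ kRadius G (k / 2) := by
  refine le_iInf₂ fun U hU => ?_
  obtain ⟨S, hUS, hSk, hS⟩ := exists_noIsolated_superset hG hk hkn U hU
  exact (iInf₂_le S ⟨hSk, hS⟩).trans (coverRadius_anti G (Finset.coe_subset.2 hUS))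

/-! ### Flooding in one round -/

theorem floodTime_ne_zero [Fintype V] {G : SimpleGraph V} (hG : G.Connected)
    (hn : 2 ≤ Fintype.card V) {S : Set V} (hS : S.Nonempty) : ¬ floodTime G S ≤ 0 := by
  rw [floodTime_le_zero_iff, Set.eq_empty_iff_forall_notMem]
  obtain ⟨s, hs⟩ := hS
  obtain ⟨w, hw⟩ := exists_adj hG hn s
  exact fun h => h w ⟨s, hs, hw⟩

theorem floodTime_le_one_iff [Fintype V] {G : SimpleGraph V} (hG : G.Connected)
    {S : Finset V} (hS : S.Nonempty) :
    floodTime G (S : Set V) ≤ 1 ↔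
      S = Finset.univ ∨ ∃ T : Finset V, G.IsBipartiteWith (S : Set V) (T : Set V) ∧
        (S : Set V) ∪ (T : Set V) = Set.univ := by
  classical
  have h01 := floodTime_le_succ_iff G (S : Set V) 0
  simp only [zero_add, Nat.cast_one] at h01
  rw [h01]
  constructor
  · intro h
    have hN : ∀ s ∈ S, ∀ v, G.Adj s v → ∀ u, G.Adj v u → u ∈ S :=
      fun s hs v hv u hu => h ⟨v, ⟨s, hs, hv⟩, hu⟩
    by_cases hind : ∃ s ∈ S, ∃ t ∈ S, G.Adj s t
    · left
      obtain ⟨s, hs, t, ht, hst⟩ := hind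
      by_contra hne
      -- With an edge inside `S`, closure under two-step walks makes this set closed under
      -- adjacency, so connectivity forces it to be `V`.
      have hproper : {v | v ∈ S ∧ ∃ w ∈ S, G.Adj w v} ≠ Set.univ := by
        intro hu
        apply hne
        ext v
        have : v ∈ {v | v ∈ S ∧ ∃ w ∈ S, G.Adj w v} := hu ▸ Set.mem_univ v
        simpa using this.1
      obtain ⟨u, ⟨hu, w, hw, hwu⟩, x, hx, hux⟩ :=
        exists_adj_notMem hG (Set.nonempty_of_mem (x := s) (by exact ⟨hs, t, ht, hst.symm⟩)) hproper
      exact hx ⟨hN w hw u hwu x hux, u, hu, hux⟩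
    · right
      push Not at hind
      have hcov : ∀ v, v ∉ S → ∃ s ∈ S, G.Adj s v := by
        by_contra! hcon
        obtain ⟨v, hv, hvn⟩ := hcon
        have hproper : {v | v ∈ S ∨ ∃ w ∈ S, G.Adj w v} ≠ Set.univ := by
          intro hu
          have : v ∈ {v | v ∈ S ∨ ∃ w ∈ S, G.Adj w v} := hu ▸ Set.mem_univ v
          rcases this with h1 | ⟨w, hw, hwv⟩
          · exact hv h1
          · exact hvn w hw hwv
        obtain ⟨s, hs⟩ := hS
        obtain ⟨u, hu, x, hx, hux⟩ := exists_adj_notMem hG ⟨s, Or.inl hs⟩ hproper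
        rcases hu with hu | ⟨w, hw, hwu⟩
        · exact hx (Or.inr ⟨u, hu, hux⟩)
        · exact hx (Or.inl (hN w hw u hwu x hux))
      refine ⟨Sᶜ, ⟨?_, ?_⟩, by simp⟩
      · simpa using disjoint_compl_right
      · intro v w hvw
        by_cases hv : v ∈ S
        · left
          exact ⟨hv, by simpa using fun hw => hind v hv w hw hvw⟩
        · right
          obtain ⟨s, hs, hsv⟩ := hcov v hv
          exact ⟨by simpa using hv, hN s hs v hsv w hvw⟩
  · rintro (rfl | ⟨T, hb, -⟩)
    · intro v _
      simp [reach]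
    · rintro u ⟨v, ⟨s, hs, hsv⟩, hvu⟩
      exact hb.mem_of_mem_adj' (hb.mem_of_mem_adj hs hsv) hvu.symm

theorem flood_eq_one_iff [Fintype V] {G : SimpleGraph V} (hG : G.Connected)
    (hn : 2 ≤ Fintype.card V) {k : ℕ} (hk : 1 ≤ k) :
    flood G k = 1 ↔ Fintype.card V = k ∨
      ∃ V₁ V₂ : Finset V, G.IsBipartiteWith (V₁ : Set V) (V₂ : Set V) ∧
        (V₁ : Set V) ∪ (V₂ : Set V) = Set.univ ∧ (V₁.card = k ∨ V₂.card = k) := by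
  have hne : ∀ S : Finset V, S.card = k → S.Nonempty :=
    fun S hS => Finset.card_pos.1 (by omega)
  have hpos : flood G k ≠ 0 := by
    intro h0
    obtain ⟨S, hS, h⟩ := (flood_le_iff G k 0).1 h0.le
    exact floodTime_ne_zero hG hn (Finset.coe_nonempty.2 (hne S hS)) h
  have hone : flood G k = 1 ↔ flood G k ≤ (1 : ℕ) := by
    rw [Nat.cast_one]
    exact ⟨le_of_eq, fun h => le_antisymm h (Order.one_le_iff_pos.2 (pos_iff_ne_zero.2 hpos))⟩
  rw [hone, flood_le_iff]
  constructor
  · rintro ⟨S, hS, h⟩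
    rcases (floodTime_le_one_iff hG (hne S hS)).1 h with rfl | ⟨T, hb, hu⟩
    · exact Or.inl (by simpa using hS)
    · exact Or.inr ⟨S, T, hb, hu, Or.inl hS⟩
  · rintro (h | ⟨V₁, V₂, hb, hu, h | h⟩)
    · exact ⟨Finset.univ, by simpa using h,
        (floodTime_le_one_iff hG (hne _ (by simpa using h))).2 (Or.inl rfl)⟩
    · exact ⟨V₁, h, (floodTime_le_one_iff hG (hne _ h)).2 (Or.inr ⟨V₂, hb, hu⟩)⟩
    · exact ⟨V₂, h, (floodTime_le_one_iff hG (hne _ h)).2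
        (Or.inr ⟨V₁, hb.symm, by rw [Set.union_comm, hu]⟩)⟩

/-! ### Transversals of 3-uniform hypergraphs -/

/-- A finite graph in which every vertex has at least three neighbours contains an even cycle. -/
theorem exists_even_cycle {W : Type*} [Finite W] [Nonempty W] (L : SimpleGraph W)
    (h : ∀ v a b, ∃ c, L.Adj v c ∧ c ≠ a ∧ c ≠ b) :
    ∃ (m : ℕ) (q : ℕ → W), 2 ≤ m ∧ Set.InjOn q (Set.Iio (2 * m)) ∧
      (∀ t, t + 1 < 2 * m → L.Adj (q t) (q (t + 1))) ∧ L.Adj (q (2 * m - 1)) (q 0) := by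
  classical
  have := Fintype.ofFinite W
  let P : ℕ → Prop := fun l => ∃ p : ℕ → W, Set.InjOn p (Set.Iic l) ∧
    ∀ t < l, L.Adj (p t) (p (t + 1))
  have hP0 : P 0 := by
    obtain ⟨w⟩ := ‹Nonempty W›
    refine ⟨fun _ => w, ?_, by simp⟩
    intro a ha b hb _
    simp only [Set.mem_Iic] at ha hb
    omega
  have hPb : ∀ l, P l → l < Fintype.card W := by
    rintro l ⟨p, hp, -⟩
    have h1 := Finset.card_le_univ ((Finset.Iic l).image p)
    rw [Finset.card_image_of_injOn (by simpa using hp), Nat.card_Iic] at h1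
    omega
  obtain ⟨l, ⟨p, hinj, hadj⟩, hmax⟩ : ∃ l, P l ∧ ¬ P (l + 1) := by
    by_contra! hcon
    have hall : ∀ l, P l := fun l => Nat.rec hP0 (fun l ih => hcon l ih) l
    exact lt_irrefl _ (hPb _ (hall (Fintype.card W)))
  -- The path `p` is longest, so all neighbours of its end `p 0` lie on it.
  have hon : ∀ c, L.Adj (p 0) c → ∃ i ≤ l, p i = c := by
    intro c hc
    by_contra! hcon
    refine hmax ⟨fun t => if t = 0 then c else p (t - 1), ?_, ?_⟩
    · intro a ha b hb hab
      simp only [Set.mem_Iic] at ha hb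
      by_cases ha0 : a = 0 <;> by_cases hb0 : b = 0 <;> simp only [ha0, hb0, if_true, if_false] at hab
      · omega
      · exact absurd hab.symm (hcon _ (by omega))
      · exact absurd hab (hcon _ (by omega))
      · have := hinj (by simp; omega : a - 1 ∈ Set.Iic l) (by simp; omega : b - 1 ∈ Set.Iic l) hab
        omega
    · intro t ht
      rcases t with _ | t
      · simpa using hc.symm
      · simpa using hadj t (by omega)
  -- This yields two chords at `p 0`. A chord to an odd index `i` closes a cycle of `i + 1`
  -- vertices; chords to even `i < j` close `p 0, p i, …, p j`, of `j - i + 2` vertices.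
  have hchord : ∀ a, ∃ i, 2 ≤ i ∧ i ≤ l ∧ L.Adj (p 0) (p i) ∧ p i ≠ a := by
    intro a
    obtain ⟨c, hc, hca, hc1⟩ := h (p 0) a (p 1)
    obtain ⟨i, hi, rfl⟩ := hon c hc
    refine ⟨i, ?_, hi, hc, hca⟩
    by_contra hlt
    obtain rfl | rfl : i = 0 ∨ i = 1 := by omega
    · exact L.irrefl hc
    · exact hc1 rfl
  have hodd : ∀ i, 2 ≤ i → i ≤ l → L.Adj (p 0) (p i) → i % 2 = 1 →
      ∃ (m : ℕ) (q : ℕ → W), 2 ≤ m ∧ Set.InjOn q (Set.Iio (2 * m)) ∧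
      (∀ t, t + 1 < 2 * m → L.Adj (q t) (q (t + 1))) ∧ L.Adj (q (2 * m - 1)) (q 0) := by
    intro i hi hil hadji hodd
    refine ⟨(i + 1) / 2, p, by omega, ?_, fun t ht => hadj t (by omega), ?_⟩
    · refine hinj.mono fun t ht => ?_
      simp only [Set.mem_Iio, Set.mem_Iic] at ht ⊢
      omega
    · rw [show 2 * ((i + 1) / 2) - 1 = i by omega]
      exact hadji.symm
  have heven : ∀ i j, 2 ≤ i → i < j → j ≤ l → L.Adj (p 0) (p i) → L.Adj (p 0) (p j) →
      i % 2 = 0 → j % 2 = 0 →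
      ∃ (m : ℕ) (q : ℕ → W), 2 ≤ m ∧ Set.InjOn q (Set.Iio (2 * m)) ∧
      (∀ t, t + 1 < 2 * m → L.Adj (q t) (q (t + 1))) ∧ L.Adj (q (2 * m - 1)) (q 0) := by
    intro i j hi hij hjl hadji hadjj hi2 hj2
    refine ⟨(j - i + 2) / 2, fun t => if t = 0 then p 0 else p (i + t - 1), by omega, ?_, ?_, ?_⟩
    · intro a ha b hb hab
      simp only [Set.mem_Iio] at ha hb
      have hp : p (if a = 0 then 0 else i + a - 1) = p (if b = 0 then 0 else i + b - 1) := by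
        rw [apply_ite p, apply_ite p]
        exact hab
      have := hinj (Set.mem_Iic.2 (by split_ifs <;> omega))
        (Set.mem_Iic.2 (by split_ifs <;> omega)) hp
      split_ifs at this <;> omega
    · intro t ht
      rcases t with _ | t
      · simpa using hadji
      · have h1 := hadj (i + t) (by omega)
        simpa [← add_assoc] using h1
    · have h1 : 2 * ((j - i + 2) / 2) - 1 ≠ 0 := by omega
      simp only [h1, if_false, if_true]
      rw [show i + (2 * ((j - i + 2) / 2) - 1) - 1 = j by omega]
      exact hadjj.symm
  obtain ⟨i, hi, hil, hadji, -⟩ := hchord (p 0)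
  obtain ⟨j, hj, hjl, hadjj, hij⟩ := hchord (p i)
  have hne : i ≠ j := fun h => hij (h ▸ rfl)
  rcases Nat.mod_two_eq_zero_or_one i with hi2 | hi2
  · rcases Nat.mod_two_eq_zero_or_one j with hj2 | hj2
    · rcases lt_or_gt_of_ne hne with hlt | hlt
      · exact heven i j hi hlt hjl hadji hadjj hi2 hj2
      · exact heven j i hj hlt hil hadjj hadji hj2 hi2
    · exact hodd j hj hjl hadjj hj2
  · exact hodd i hi hil hadji hi2

/-- If `T₀` meets the edges in `E₀`, the vertices of `R` lie on no other edge, and the removal of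
`R` and `E₀` is paid for, then a small transversal of the remaining hypergraph extends. -/
theorem exists_transversal_of_remove {α ι : Type*} [DecidableEq α] [DecidableEq ι]
    {f : ι → Finset α} {X : Finset α} {E : Finset ι}
    (ih : ∀ (X' : Finset α) (E' : Finset ι), X'.card + E'.card < X.card + E.card →
      (∀ i ∈ E', f i ⊆ X' ∧ (f i).card = 3) →
      ∃ T ⊆ X', (∀ i ∈ E', ∃ x ∈ T, x ∈ f i) ∧ 4 * T.card ≤ X'.card + E'.card)
    (hf : ∀ i ∈ E, f i ⊆ X ∧ (f i).card = 3)
    (T₀ R : Finset α) (E₀ : Finset ι) (hT₀ : T₀ ⊆ X) (hR : R ⊆ X) (hE₀ : E₀ ⊆ E)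
    (hpos : 0 < R.card + E₀.card) (hpay : 4 * T₀.card ≤ R.card + E₀.card)
    (hcov : ∀ i ∈ E₀, ∃ x ∈ T₀, x ∈ f i)
    (hdisj : ∀ i ∈ E, i ∉ E₀ → ∀ x ∈ f i, x ∉ R) :
    ∃ T ⊆ X, (∀ i ∈ E, ∃ x ∈ T, x ∈ f i) ∧ 4 * T.card ≤ X.card + E.card := by
  have hX := Finset.card_sdiff_add_card_eq_card hR
  have hE := Finset.card_sdiff_add_card_eq_card hE₀
  obtain ⟨T, hTX, hTcov, hTcard⟩ := ih (X \ R) (E \ E₀) (by omega) (by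
    intro i hi
    rw [Finset.mem_sdiff] at hi
    exact ⟨fun x hx => Finset.mem_sdiff.2 ⟨(hf i hi.1).1 hx, hdisj i hi.1 hi.2 x hx⟩,
      (hf i hi.1).2⟩)
  refine ⟨T₀ ∪ T, Finset.union_subset hT₀ (hTX.trans Finset.sdiff_subset), ?_, ?_⟩
  · intro i hi
    by_cases hi0 : i ∈ E₀
    · obtain ⟨x, hx, hxi⟩ := hcov i hi0
      exact ⟨x, Finset.mem_union_left _ hx, hxi⟩
    · obtain ⟨x, hx, hxi⟩ := hTcov i (Finset.mem_sdiff.2 ⟨hi, hi0⟩)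
      exact ⟨x, Finset.mem_union_right _ hx, hxi⟩
  · have := Finset.card_union_le T₀ T
    omega

/-- In a 3-uniform hypergraph all of whose vertices have degree two and in which no two edges
share two vertices, there is an even cycle of edges. -/
theorem exists_even_edge_cycle {α ι : Type*} [DecidableEq α] [DecidableEq ι]
    {f : ι → Finset α} {E : Finset ι} (hE : E.Nonempty)
    (hf : ∀ i ∈ E, (f i).card = 3)
    (hdeg : ∀ i ∈ E, ∀ x ∈ f i, ∃ j ∈ E, x ∈ f j ∧ j ≠ i)
    (hlin : ∀ i ∈ E, ∀ j ∈ E, i ≠ j → ∀ x ∈ f i, x ∈ f j → ∀ y ∈ f i, y ∈ f j → x = y) :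
    ∃ (m : ℕ) (q : ℕ → ι) (w : ℕ → α), 2 ≤ m ∧ Set.InjOn q (Set.Iio (2 * m)) ∧
      (∀ t < 2 * m, q t ∈ E) ∧
      ∀ t < 2 * m, w t ∈ f (q t) ∧ w t ∈ f (q (if t + 1 = 2 * m then 0 else t + 1)) := by
  let L : SimpleGraph E :=
    { Adj := fun i j => i ≠ j ∧ ∃ x, x ∈ f i ∧ x ∈ f j
      symm := ⟨fun i j h => ⟨h.1.symm, h.2.imp fun x hx => hx.symm⟩⟩
      loopless := ⟨fun i h => h.1 rfl⟩ }
  have : Nonempty E := hE.to_subtype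
  obtain ⟨m, q, hm, hinj, hadj, hlast⟩ := exists_even_cycle L (by
    intro i a b
    by_contra! hcon
    have : Nonempty ι := ⟨i⟩
    choose! g hgE hgx hgi using hdeg i i.2
    -- If `i` met no edge other than `a` and `b`, two of its three vertices would lead to the same
    -- edge, against linearity.
    have hmaps : ∀ x ∈ f i, g x ∈ ({a.1, b.1} : Finset ι) := by
      intro x hx
      have := hcon ⟨g x, hgE x hx⟩
        ⟨fun h => hgi x hx (congrArg Subtype.val h).symm, x, hx, hgx x hx⟩
      by_cases hga : g x = a.1
      · simp [hga]
      · have h2 := this fun h => hga (congrArg Subtype.val h)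
        simp [← congrArg Subtype.val h2]
    obtain ⟨x, hx, y, hy, hxy, hg⟩ := Finset.exists_ne_map_eq_of_card_lt_of_maps_to
      (by rw [hf i i.2]; exact Finset.card_le_two.trans_lt (by norm_num)) hmaps
    exact hxy (hlin i i.2 (g x) (hgE x hx) (hgi x hx).symm x hx (hgx x hx) y hy
      (hg ▸ hgx y hy)))
  have hcyc : ∀ t < 2 * m, L.Adj (q t) (q (if t + 1 = 2 * m then 0 else t + 1)) := by
    intro t ht
    split_ifs with h
    · rwa [show t = 2 * m - 1 by omega]
    · exact hadj t (by omega)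
  obtain ⟨i₀, hi₀⟩ := hE
  obtain ⟨x₀, -⟩ := Finset.card_pos.1 (by rw [hf i₀ hi₀]; norm_num : 0 < (f i₀).card)
  have : Nonempty α := ⟨x₀⟩
  choose! w hw using fun t ht => (hcyc t ht).2
  exact ⟨m, fun t => q t, w, hm, fun a ha b hb hab => hinj ha hb (Subtype.ext hab),
    fun t _ => (q t).2, hw⟩

/-- A 3-uniform hypergraph with vertex set `X` and edge set `E` has a transversal of size at most
`(|X| + |E|) / 4`. -/
theorem exists_transversal_of_card_eq_three {α ι : Type*} (f : ι → Finset α) (X : Finset α)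
    (E : Finset ι) (hf : ∀ i ∈ E, f i ⊆ X ∧ (f i).card = 3) :
    ∃ T ⊆ X, (∀ i ∈ E, ∃ x ∈ T, x ∈ f i) ∧ 4 * T.card ≤ X.card + E.card := by
  classical
  induction hN : X.card + E.card using Nat.strong_induction_on generalizing X E with
  | _ N ih =>
  subst hN
  have red := exists_transversal_of_remove (f := f) (X := X) (E := E)
    (fun X' E' hlt hf' => ih _ hlt X' E' hf' rfl) hf
  -- Each chosen vertex must be paid for by four removed objects: here one vertex and three edges.
  by_cases hbig : ∃ v ∈ X, 3 ≤ (E.filter (v ∈ f ·)).card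
  · obtain ⟨v, hv, hdeg⟩ := hbig
    refine red {v} {v} (E.filter (v ∈ f ·)) (by simpa) (by simpa) (Finset.filter_subset _ _)
      (by simp) (by simp; omega) ?_ ?_
    · simp
    · intro i hi hni x hx hxv
      rw [Finset.mem_singleton] at hxv
      exact hni (Finset.mem_filter.2 ⟨hi, hxv ▸ hx⟩)
  by_cases hzero : ∃ v ∈ X, ∀ i ∈ E, v ∉ f i
  · obtain ⟨v, hv, hdeg⟩ := hzero
    refine red ∅ {v} ∅ (by simp) (by simpa) (by simp) (by simp) (by simp) (by simp) ?_
    intro i hi _ x hx hxv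
    rw [Finset.mem_singleton] at hxv
    exact hdeg i hi (hxv ▸ hx)
  push Not at hbig hzero
  by_cases hone : ∃ i ∈ E, ∃ x ∈ f i, ∀ j ∈ E, x ∈ f j → j = i
  · obtain ⟨i, hi, x, hx, hxi⟩ := hone
    -- The vertex `x` has degree one. Either `y` covers `i` and `j`, removing two vertices and two
    -- edges, or `i` is isolated and goes with its three vertices.
    by_cases hy : ∃ y ∈ f i, ∃ j ∈ E, j ≠ i ∧ y ∈ f j
    · obtain ⟨y, hyi, j, hj, hji, hyj⟩ := hy
      have hxy : x ≠ y := by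
        rintro rfl
        exact hji (hxi j hj hyj)
      refine red {y} {x, y} {i, j} (by simpa using (hf i hi).1 hyi) ?_ ?_ ?_ ?_ ?_ ?_
      · simp [Finset.insert_subset_iff, (hf i hi).1 hyi, (hf i hi).1 hx]
      · simp [Finset.insert_subset_iff, hi, hj]
      · simp [Finset.card_pair hxy]
      · simp [Finset.card_pair hxy, Finset.card_pair hji.symm]
      · simp [hyi, hyj]
      · intro a ha hna z hz hzR
        simp only [Finset.mem_insert, Finset.mem_singleton, not_or] at hzR hna
        rcases hzR with rfl | rfl
        · exact hna.1 (hxi a ha hz)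
        · have hsub : ({i, j, a} : Finset ι) ⊆ E.filter (z ∈ f ·) := by
            simp [Finset.insert_subset_iff, hi, hj, ha, hyi, hyj, hz]
          have h3 : ({i, j, a} : Finset ι).card = 3 :=
            Finset.card_eq_three.2 ⟨i, j, a, hji.symm, Ne.symm hna.1, Ne.symm hna.2, rfl⟩
          have := Finset.card_le_card hsub
          have := hbig z ((hf i hi).1 hyi)
          omega
    · push Not at hy
      refine red {x} (f i) {i} (by simpa using (hf i hi).1 hx) (hf i hi).1 (by simpa) (by simp)
        (by simp [(hf i hi).2]) (by simpa using hx) ?_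
      intro a ha hna z hz hzi
      exact hy z hzi a ha (by simpa using hna) hz
  push Not at hone
  have htwo : ∀ i ∈ E, ∀ j ∈ E, i ≠ j → ∀ x ∈ f i, x ∈ f j → ∀ a ∈ E, x ∈ f a →
      a = i ∨ a = j := by
    intro i hi j hj hij x hx hxj a ha hxa
    by_contra! hna
    have hsub : ({i, j, a} : Finset ι) ⊆ E.filter (x ∈ f ·) := by
      simp [Finset.insert_subset_iff, hi, hj, ha, hx, hxj, hxa]
    have h3 : ({i, j, a} : Finset ι).card = 3 :=
      Finset.card_eq_three.2 ⟨i, j, a, hij, Ne.symm hna.1, Ne.symm hna.2, rfl⟩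
    have := Finset.card_le_card hsub
    have := hbig x ((hf i hi).1 hx)
    omega
  by_cases hlin : ∃ i ∈ E, ∃ j ∈ E, i ≠ j ∧ ∃ x ∈ f i, x ∈ f j ∧ ∃ y ∈ f i, y ∈ f j ∧ x ≠ y
  · obtain ⟨i, hi, j, hj, hij, x, hxi, hxj, y, hyi, hyj, hxy⟩ := hlin
    refine red {x} {x, y} {i, j} (by simpa using (hf i hi).1 hxi) ?_ ?_ ?_ ?_ ?_ ?_
    · simp [Finset.insert_subset_iff, (hf i hi).1 hyi, (hf i hi).1 hxi]
    · simp [Finset.insert_subset_iff, hi, hj]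
    · simp [Finset.card_pair hxy]
    · simp [Finset.card_pair hxy, Finset.card_pair hij]
    · simp [hxi, hxj]
    · intro a ha hna z hz hzR
      simp only [Finset.mem_insert, Finset.mem_singleton] at hzR hna
      rcases hzR with rfl | rfl
      · exact hna (htwo i hi j hj hij z hxi hxj a ha hz)
      · exact hna (htwo i hi j hj hij z hyi hyj a ha hz)
  push Not at hlin
  rcases E.eq_empty_or_nonempty with rfl | hE
  · exact ⟨∅, by simp, by simp, by simp⟩
  -- What remains is linear with all degrees two. In an even cycle of `2m` edges, every other
  -- linking vertex covers all of them: `m` choices against `2m` vertices and `2m` edges.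
  obtain ⟨m, q, w, hm, hinj, hqE, hw⟩ := exists_even_edge_cycle hE (fun i hi => (hf i hi).2) hone
    hlin
  have hsucc : ∀ t < 2 * m, (if t + 1 = 2 * m then 0 else t + 1) < 2 * m := by
    intro t ht
    split_ifs <;> omega
  have hqne : ∀ t < 2 * m, q t ≠ q (if t + 1 = 2 * m then 0 else t + 1) := by
    intro t ht h
    have := hinj ht (hsucc t ht) h
    split_ifs at this <;> omega
  have honly : ∀ t < 2 * m, ∀ a ∈ E, w t ∈ f a →
      a = q t ∨ a = q (if t + 1 = 2 * m then 0 else t + 1) := fun t ht =>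
    htwo _ (hqE t ht) _ (hqE _ (hsucc t ht)) (hqne t ht) _ (hw t ht).1 (hw t ht).2
  have hwinj : Set.InjOn w (Set.Iio (2 * m)) := by
    intro a ha b hb hab
    simp only [Set.mem_Iio] at ha hb
    have h1 := honly b hb (q a) (hqE a ha) (hab ▸ (hw a ha).1)
    have h2 := honly a ha (q b) (hqE b hb) (hab ▸ (hw b hb).1)
    rcases h1 with h1 | h1
    · exact hinj ha hb h1
    rcases h2 with h2 | h2
    · exact (hinj hb ha h2).symm
    -- Now `a` and `b` are cyclic successors of each other, impossible as `2m ≥ 4`.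
    have h3 := hinj ha (hsucc b hb) h1
    have h4 := hinj hb (hsucc a ha) h2
    split_ifs at h3 h4 <;> omega
  have hqcard : ((Finset.range (2 * m)).image q).card = 2 * m := by
    rw [Finset.card_image_of_injOn (by simpa using hinj), Finset.card_range]
  have hwcard : ((Finset.range (2 * m)).image w).card = 2 * m := by
    rw [Finset.card_image_of_injOn (by simpa using hwinj), Finset.card_range]
  have hwX : ∀ t < 2 * m, w t ∈ X := fun t ht => (hf _ (hqE t ht)).1 (hw t ht).1
  refine red ((Finset.range m).image fun s => w (2 * s)) ((Finset.range (2 * m)).image w)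
    ((Finset.range (2 * m)).image q) ?_ ?_ ?_ (by omega) ?_ ?_ ?_
  · simp only [Finset.image_subset_iff, Finset.mem_range]
    exact fun s hs => hwX _ (by omega)
  · simpa only [Finset.image_subset_iff, Finset.mem_range] using hwX
  · simpa only [Finset.image_subset_iff, Finset.mem_range] using hqE
  · have := Finset.card_image_le (s := Finset.range m) (f := fun s => w (2 * s))
    rw [Finset.card_range] at this
    omega
  · simp only [Finset.mem_image, Finset.mem_range, forall_exists_index, and_imp,
      forall_apply_eq_imp_iff₂]
    intro t ht
    refine ⟨w (2 * (t / 2)), ⟨t / 2, by omega, rfl⟩, ?_⟩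
    rcases Nat.mod_two_eq_zero_or_one t with h2 | h2
    · rw [show 2 * (t / 2) = t by omega]
      exact (hw t ht).1
    · have h1 := (hw (2 * (t / 2)) (by omega)).2
      rwa [if_neg (by omega), show 2 * (t / 2) + 1 = t by omega] at h1
  · simp only [Finset.mem_image, Finset.mem_range, not_exists, not_and]
    intro a ha hna z hz t ht hzt
    subst hzt
    rcases honly t ht a ha hz with h | h
    · exact hna t ht h.symm
    · exact hna _ (hsucc t ht) h.symm

/-! ### Total domination -/

/-- Every vertex has a neighbour in `S`. -/
def IsTotalDominating (G : SimpleGraph V) (S : Finset V) : Prop :=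
  ∀ v, ∃ w ∈ S, G.Adj v w

theorem IsTotalDominating.mono {G : SimpleGraph V} {S T : Finset V}
    (hS : IsTotalDominating G S) (h : S ⊆ T) : IsTotalDominating G T := fun v =>
  let ⟨w, hw, hvw⟩ := hS v
  ⟨w, h hw, hvw⟩

/-- Three neighbours of each vertex form a hypergraph with `n` vertices and `n` edges, whose
transversals are total dominating sets. -/
theorem exists_isTotalDominating_of_three_le_minDegree [Fintype V] (G : SimpleGraph V)
    [DecidableRel G.Adj] (hG : 3 ≤ G.minDegree) :
    ∃ S : Finset V, IsTotalDominating G S ∧ 2 * S.card ≤ Fintype.card V := by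
  have h3 : ∀ v, ∃ t ⊆ G.neighborFinset v, t.card = 3 := fun v =>
    Finset.exists_subset_card_eq (by
      rw [G.card_neighborFinset_eq_degree]
      exact hG.trans (G.minDegree_le_degree v))
  choose f hf hf3 using h3
  obtain ⟨T, -, hT, hcard⟩ := exists_transversal_of_card_eq_three f Finset.univ Finset.univ
    fun i _ => ⟨Finset.subset_univ _, hf3 i⟩
  refine ⟨T, fun v => ?_, ?_⟩
  · obtain ⟨x, hx, hxv⟩ := hT v (Finset.mem_univ v)
    exact ⟨x, hx, (G.mem_neighborFinset v x).1 (hf v hxv)⟩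
  · rw [Finset.card_univ] at hcard
    omega

/-- A minimal total dominating set: each of its vertices has a private neighbour. -/
theorem exists_private_neighbor {G : SimpleGraph V} {S : Finset V} (hS : IsTotalDominating G S)
    (hmin : ∀ T, IsTotalDominating G T → S.card ≤ T.card) {v : V} (hv : v ∈ S) :
    ∃ w, G.Adj w v ∧ ∀ x ∈ S, G.Adj w x → x = v := by
  classical
  by_contra! hcon
  have hT : IsTotalDominating G (S.erase v) := by
    intro w
    obtain ⟨x, hx, hwx⟩ := hS w
    by_cases hxv : x = v
    · subst hxv
      obtain ⟨y, hy, hwy, hne⟩ := hcon w hwx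
      exact ⟨y, Finset.mem_erase.2 ⟨hne, hy⟩, hwy⟩
    · exact ⟨x, Finset.mem_erase.2 ⟨hxv, hx⟩, hwx⟩
  have := hmin _ hT
  have := Finset.card_erase_lt_of_mem hv
  omega

/-- The ordered pairs of adjacent vertices inside `S`. -/
noncomputable def innerDarts (G : SimpleGraph V) (S : Finset V) : Finset (V × V) := by
  classical exact (S ×ˢ S).filter fun e => G.Adj e.1 e.2

theorem mem_innerDarts {G : SimpleGraph V} {S : Finset V} {e : V × V} :
    e ∈ innerDarts G S ↔ (e.1 ∈ S ∧ e.2 ∈ S) ∧ G.Adj e.1 e.2 := by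
  simp [innerDarts]

/-- If `{b, w}` is an isolated edge of `G[S]`, `w` has no private neighbour outside `S`, and `x`
is a neighbour of `b` outside `S` with a further neighbour `y` in `S`, then exchanging `w` for `x`
preserves total domination and increases the number of inner edges. -/
theorem exchange_of_isolated_edge [DecidableEq V] {G : SimpleGraph V} {S : Finset V}
    (hS : IsTotalDominating G S) {b w x y : V} (hb : b ∈ S) (hw : w ∈ S) (hbw : G.Adj b w)
    (hbS : ∀ y ∈ S, G.Adj b y → y = w) (hwS : ∀ y ∈ S, G.Adj w y → y = b)
    (hwn : ∀ z ∉ S, G.Adj z w → ∃ y ∈ S, G.Adj z y ∧ y ≠ w)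
    (hx : x ∉ S) (hbx : G.Adj b x) (hy : y ∈ S) (hxy : G.Adj x y) (hyb : y ≠ b) (hyw : y ≠ w) :
    IsTotalDominating G (insert x (S.erase w)) ∧ (insert x (S.erase w)).card = S.card ∧
      (innerDarts G S).card < (innerDarts G (insert x (S.erase w))).card := by
  have hkeep : ∀ z ∈ S, z ≠ w → z ∈ insert x (S.erase w) := fun z hz hne =>
    Finset.mem_insert_of_mem (Finset.mem_erase.2 ⟨hne, hz⟩)
  refine ⟨?_, ?_, ?_⟩
  · intro z
    obtain ⟨u, hu, hzu⟩ := hS z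
    by_cases huw : u = w
    · subst huw
      by_cases hzS : z ∈ S
      · obtain rfl := hwS z hzS hzu.symm
        exact ⟨x, Finset.mem_insert_self _ _, hbx⟩
      · obtain ⟨u', hu', hzu', hne⟩ := hwn z hzS hzu
        exact ⟨u', hkeep u' hu' hne, hzu'⟩
    · exact ⟨u, hkeep u hu huw, hzu⟩
  · rw [Finset.card_insert_of_notMem fun h => hx (Finset.mem_of_mem_erase h),
      Finset.card_erase_add_one hw]
  · have hxb : x ≠ b := fun h => hx (h ▸ hb)
    have hQ : ({(b, x), (x, b), (x, y)} : Finset (V × V)).card = 3 :=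
      Finset.card_eq_three.2 ⟨_, _, _, by simp [hxb], by simp [hxb.symm], by simp [hyb.symm], rfl⟩
    have hdisj : Disjoint (innerDarts G S \ {(b, w), (w, b)}) {(b, x), (x, b), (x, y)} := by
      rw [Finset.disjoint_right]
      intro e he hmem
      have hm := (mem_innerDarts.1 (Finset.mem_sdiff.1 hmem).1).1
      simp only [Finset.mem_insert, Finset.mem_singleton] at he
      rcases he with rfl | rfl | rfl
      · exact hx hm.2
      · exact hx hm.1
      · exact hx hm.1
    have hsub : (innerDarts G S \ {(b, w), (w, b)}) ∪ {(b, x), (x, b), (x, y)} ⊆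
        innerDarts G (insert x (S.erase w)) := by
      rintro ⟨p, q⟩ he
      rw [mem_innerDarts]
      rcases Finset.mem_union.1 he with he | he
      · obtain ⟨hm, hne⟩ := Finset.mem_sdiff.1 he
        obtain ⟨⟨hp, hq⟩, hpq⟩ := mem_innerDarts.1 hm
        simp only [Finset.mem_insert, Finset.mem_singleton, Prod.mk.injEq, not_or, not_and] at hne
        refine ⟨⟨hkeep p hp ?_, hkeep q hq ?_⟩, hpq⟩
        · rintro rfl
          exact hne.2 rfl (hwS q hq hpq)
        · rintro rfl
          exact hne.1 (hwS p hp hpq.symm) rfl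
      · simp only [Finset.mem_insert, Finset.mem_singleton, Prod.mk.injEq] at he
        have hxm := Finset.mem_insert_self x (S.erase w)
        rcases he with ⟨rfl, rfl⟩ | ⟨rfl, rfl⟩ | ⟨rfl, rfl⟩
        · exact ⟨⟨hkeep _ hb hbw.ne, hxm⟩, hbx⟩
        · exact ⟨⟨hxm, hkeep _ hb hbw.ne⟩, hbx.symm⟩
        · exact ⟨⟨hxm, hkeep _ hy hyw⟩, hxy⟩
    have h1 := Finset.card_le_card hsub
    rw [Finset.card_union_of_disjoint hdisj, hQ] at h1
    have h2 := Finset.le_card_sdiff ({(b, w), (w, b)} : Finset (V × V)) (innerDarts G S)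
    have h3 : ({(b, w), (w, b)} : Finset (V × V)).card ≤ 2 := Finset.card_le_two
    omega

/-- In a minimum total dominating set with as many inner edges as possible, each vertex can be
charged to a vertex outside that has one or two neighbours in the set. -/
theorem exists_charge [Fintype V] [DecidableEq V] {G : SimpleGraph V} [DecidableRel G.Adj]
    (hG : G.Connected) (hn : 3 ≤ Fintype.card V) {S : Finset V} (hS : IsTotalDominating G S)
    (hmin : ∀ T, IsTotalDominating G T → S.card ≤ T.card)
    (hmax : ∀ T, IsTotalDominating G T → T.card = S.card →
      (innerDarts G T).card ≤ (innerDarts G S).card) {v : V} (hv : v ∈ S) :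
    ∃ x ∉ S, (∃ a, S.filter (G.Adj x) = {a} ∧ (v = a ∨ S.filter (G.Adj a) = {v})) ∨
      (v ∈ S.filter (G.Adj x) ∧ (S.filter (G.Adj x)).card = 2) := by
  have hpriv : ∀ v ∈ S, ∃ w, S.filter (G.Adj w) = {v} := by
    intro v hv
    obtain ⟨w, hwv, hw⟩ := exists_private_neighbor hS hmin hv
    refine ⟨w, Finset.eq_singleton_iff_unique_mem.2 ⟨Finset.mem_filter.2 ⟨hv, hwv⟩, ?_⟩⟩
    exact fun x hx => hw x (Finset.mem_filter.1 hx).1 (Finset.mem_filter.1 hx).2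
  by_cases hve : ∃ x ∉ S, S.filter (G.Adj x) = {v}
  · obtain ⟨x, hx, hxv⟩ := hve
    exact ⟨x, hx, Or.inl ⟨v, hxv, Or.inl rfl⟩⟩
  obtain ⟨w, hw⟩ := hpriv v hv
  have hwS : w ∈ S := by
    by_contra h
    exact hve ⟨w, h, hw⟩
  by_cases hwe : ∃ x ∉ S, S.filter (G.Adj x) = {w}
  · obtain ⟨x, hx, hxw⟩ := hwe
    exact ⟨x, hx, Or.inl ⟨w, hxw, Or.inr hw⟩⟩
  obtain ⟨v', hv'⟩ := hpriv w hwS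
  have hv'S : v' ∈ S := by
    by_contra h
    exact hwe ⟨v', h, hv'⟩
  have hmemw : ∀ y, y ∈ S → G.Adj w y → y = v := fun y hy hwy =>
    Finset.mem_singleton.1 (hw ▸ Finset.mem_filter.2 ⟨hy, hwy⟩)
  have hv'w : G.Adj v' w := (Finset.mem_filter.1 (hv' ▸ Finset.mem_singleton_self w)).2
  -- With no outside private neighbour for `v` or `w`, the two are each other's only neighbours in
  -- `S`.
  obtain rfl := hmemw v' hv'S hv'w.symm
  have hmemv : ∀ y, y ∈ S → G.Adj v' y → y = w := fun y hy hwy =>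
    Finset.mem_singleton.1 (hv' ▸ Finset.mem_filter.2 ⟨hy, hwy⟩)
  have hnotpriv : ∀ u ∈ S, (¬ ∃ x ∉ S, S.filter (G.Adj x) = {u}) →
      ∀ z ∉ S, G.Adj z u → ∃ y ∈ S, G.Adj z y ∧ y ≠ u := by
    intro u hu hue z hz hzu
    by_contra! hcon
    refine hue ⟨z, hz, Finset.eq_singleton_iff_unique_mem.2 ⟨Finset.mem_filter.2 ⟨hu, hzu⟩, ?_⟩⟩
    exact fun y hy => hcon y (Finset.mem_filter.1 hy).1 (Finset.mem_filter.1 hy).2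
  have hvn := hnotpriv v' hv hve
  have hwn := hnotpriv w hwS hwe
  have hne : (({v', w} : Finset V) : Set V) ≠ Set.univ := by
    intro h
    have h1 : ({v', w} : Finset V).card ≤ 2 := Finset.card_le_two
    rw [Finset.coe_eq_univ.1 h, Finset.card_univ] at h1
    omega
  obtain ⟨u, hu, x, hx, hux⟩ := exists_adj_notMem hG ⟨v', by simp⟩ hne
  simp only [Finset.mem_coe, Finset.mem_insert, Finset.mem_singleton, not_or] at hu hx
  -- A third neighbour of `x` in `S` would permit an exchange contradicting `hmax`.
  have hcharge : ∀ b c, b ∈ S → c ∈ S → G.Adj b c → (∀ y ∈ S, G.Adj b y → y = c) →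
      (∀ y ∈ S, G.Adj c y → y = b) → (∀ z ∉ S, G.Adj z b → ∃ y ∈ S, G.Adj z y ∧ y ≠ b) →
      (∀ z ∉ S, G.Adj z c → ∃ y ∈ S, G.Adj z y ∧ y ≠ c) → x ≠ c → G.Adj b x →
      x ∉ S ∧ S.filter (G.Adj x) = {b, c} := by
    intro b c hb hc hbc hbS hcS hbn hcn hxc hbx
    have hxS : x ∉ S := fun h => hxc (hbS x h hbx)
    have hsub : ∀ y ∈ S, G.Adj x y → y = b ∨ y = c := by
      intro y hy hxy
      by_contra! hyn
      obtain ⟨h1, h2, h3⟩ :=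
        exchange_of_isolated_edge hS hb hc hbc hbS hcS hcn hxS hbx hy hxy hyn.1 hyn.2
      have := hmax _ h1 h2
      omega
    refine ⟨hxS, Finset.Subset.antisymm ?_ ?_⟩
    · intro y hy
      rw [Finset.mem_filter] at hy
      simpa using hsub y hy.1 hy.2
    · obtain ⟨y, hy, hxy, hyb⟩ := hbn x hxS hbx.symm
      obtain rfl := (hsub y hy hxy).resolve_left hyb
      simp [Finset.insert_subset_iff, hb, hc, hbx.symm, hxy]
  rcases hu with rfl | rfl
  · obtain ⟨hxS, hx2⟩ := hcharge _ _ hv hwS hv'w hmemv hmemw hvn hwn hx.2 hux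
    exact ⟨x, hxS, Or.inr ⟨by simp [hx2], by rw [hx2, Finset.card_pair hv'w.ne]⟩⟩
  · obtain ⟨hxS, hx2⟩ := hcharge _ _ hwS hv hv'w.symm hmemw hmemv hwn hvn hx.1 hux
    exact ⟨x, hxS, Or.inr ⟨by simp [hx2], by rw [hx2, Finset.card_pair hv'w.symm.ne]⟩⟩

/-- A connected graph of order at least three has a total dominating set that contains at most
two thirds of its vertices. -/
theorem exists_isTotalDominating_of_connected [Fintype V] {G : SimpleGraph V}
    (hG : G.Connected) (hn : 3 ≤ Fintype.card V) :
    ∃ S : Finset V, IsTotalDominating G S ∧ 3 * S.card ≤ 2 * Fintype.card V := by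
  classical
  have huniv : IsTotalDominating G Finset.univ := by
    intro v
    obtain ⟨w, hw⟩ := exists_adj hG (by omega) v
    exact ⟨w, Finset.mem_univ w, hw⟩
  obtain ⟨S₀, hS₀, hmin₀⟩ := Finset.exists_min_image
    (Finset.univ.filter fun S : Finset V => IsTotalDominating G S) Finset.card
    ⟨Finset.univ, by simpa using huniv⟩
  obtain ⟨S, hS, hmax⟩ := Finset.exists_max_image
    (Finset.univ.filter fun S : Finset V => IsTotalDominating G S ∧ S.card = S₀.card)
    (fun S => (innerDarts G S).card) ⟨S₀, by simpa using hS₀⟩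
  simp only [Finset.mem_filter, Finset.mem_univ, true_and] at hS hmin₀ hmax
  refine ⟨S, hS.1, ?_⟩
  choose! φ hφS hφ using fun v (hv : v ∈ S) => exists_charge hG hn hS.1
    (fun T hT => hS.2 ▸ hmin₀ T hT) (fun T hT hTS => hmax T ⟨hT, hTS.trans hS.2⟩) hv
  -- If `a` is the only neighbour of `x` in `S`, just `a` and the sole `S`-neighbour of `a`, if
  -- there is one, can be charged to `x`; otherwise only the two `S`-neighbours of `x` can. Hence
  -- `|S| ≤ 2 (n - |S|)`.
  have hfib : ∀ x ∈ Sᶜ, (S.filter fun v => φ v = x).card ≤ 2 := by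
    intro x _
    by_cases hx : ∃ a, S.filter (G.Adj x) = {a}
    · obtain ⟨a, ha⟩ := hx
      by_cases hc : ∃ c, S.filter (G.Adj a) = {c}
      · obtain ⟨c, hc⟩ := hc
        refine (Finset.card_le_card (t := {a, c}) ?_).trans Finset.card_le_two
        intro v hv
        obtain ⟨hvS, rfl⟩ := Finset.mem_filter.1 hv
        rcases hφ v hvS with ⟨b, hb, hvb⟩ | ⟨-, h2⟩
        · rw [ha, Finset.singleton_inj] at hb
          subst hb
          rcases hvb with rfl | hvb
          · simp
          · rw [hc, Finset.singleton_inj] at hvb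
            simp [hvb]
        · simp [ha] at h2
      · refine (Finset.card_le_card (t := {a}) ?_).trans (by simp)
        intro v hv
        obtain ⟨hvS, rfl⟩ := Finset.mem_filter.1 hv
        rcases hφ v hvS with ⟨b, hb, hvb⟩ | ⟨-, h2⟩
        · rw [ha, Finset.singleton_inj] at hb
          subst hb
          rcases hvb with rfl | hvb
          · simp
          · exact absurd ⟨v, hvb⟩ hc
        · simp [ha] at h2
    · rcases (S.filter fun v => φ v = x).eq_empty_or_nonempty with h0 | ⟨v₀, hv₀⟩
      · simp [h0]
      have hnot : ∀ v ∈ S.filter (fun v => φ v = x),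
          v ∈ S.filter (G.Adj x) ∧ (S.filter (G.Adj x)).card = 2 := by
        intro v hv
        obtain ⟨hvS, rfl⟩ := Finset.mem_filter.1 hv
        exact (hφ v hvS).resolve_left fun ⟨a, ha, _⟩ => hx ⟨a, ha⟩
      exact (Finset.card_le_card fun v hv => (hnot v hv).1).trans (hnot v₀ hv₀).2.le
  have hcard := Finset.card_le_mul_card_image_of_maps_to
    (fun v hv => Finset.mem_compl.2 (hφS v hv)) 2 hfib
  rw [Finset.card_compl] at hcard
  have := Finset.card_le_univ S
  omega

/-! ### Ore's bound and the bounds on `flood` -/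

/-- Ore's bound on the domination number, for a symmetric relation without isolated points. -/
theorem exists_dominating_of_symm [Fintype V] {r : V → V → Prop} (hsymm : ∀ v w, r v w → r w v)
    (hr : ∀ v, ∃ w, w ≠ v ∧ r v w) :
    ∃ S : Finset V, (∀ v ∉ S, ∃ w ∈ S, r v w) ∧ 2 * S.card ≤ Fintype.card V := by
  classical
  obtain ⟨S, hS, hmin⟩ := Finset.exists_min_image
    (Finset.univ.filter fun S : Finset V => ∀ v ∉ S, ∃ w ∈ S, r v w) Finset.card
    ⟨Finset.univ, by simp⟩
  simp only [Finset.mem_filter, Finset.mem_univ, true_and] at hS hmin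
  refine ⟨S, hS, ?_⟩
  -- By minimality the complement of `S` also dominates, so `|S| ≤ n - |S|`.
  have hcompl : ∀ v ∉ Sᶜ, ∃ w ∈ Sᶜ, r v w := by
    intro v hv
    rw [Finset.mem_compl, not_not] at hv
    by_contra! hcon
    have hdom : ∀ u ∉ S.erase v, ∃ w ∈ S.erase v, r u w := by
      intro u hu
      by_cases huv : u = v
      · subst huv
        obtain ⟨w, hwu, huw⟩ := hr u
        refine ⟨w, Finset.mem_erase.2 ⟨hwu, ?_⟩, huw⟩
        by_contra hw
        exact hcon w (Finset.mem_compl.2 hw) huw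
      · have huS : u ∉ S := fun h => hu (Finset.mem_erase.2 ⟨huv, h⟩)
        obtain ⟨w, hw, huw⟩ := hS u huS
        refine ⟨w, Finset.mem_erase.2 ⟨?_, hw⟩, huw⟩
        rintro rfl
        exact hcon u (Finset.mem_compl.2 huS) (hsymm _ _ huw)
    have := hmin _ hdom
    have := Finset.card_erase_lt_of_mem hv
    omega
  have := hmin _ hcompl
  rw [Finset.card_compl] at this
  omega

theorem IsTotalDominating.floodTime_le_two {G : SimpleGraph V} {S : Finset V}
    (hS : IsTotalDominating G S) : floodTime G (S : Set V) ≤ (2 : ℕ) := by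
  refine (floodTime_le_succ_iff G (S : Set V) 1).2 fun v _ => ?_
  obtain ⟨w, hw, hvw⟩ := hS v
  exact ⟨w, hw, hvw.symm⟩

theorem flood_le_two_of_isTotalDominating [Fintype V] {G : SimpleGraph V} {S : Finset V}
    (hS : IsTotalDominating G S) {k : ℕ} (hSk : S.card ≤ k) (hkn : k ≤ Fintype.card V) :
    flood G k ≤ (2 : ℕ) := by
  obtain ⟨T, hST, hT⟩ := Finset.exists_superset_card_eq hSk hkn
  exact (flood_le_iff G k 2).2 ⟨T, hT, (hS.mono hST).floodTime_le_two⟩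

theorem flood_card_le_one [Fintype V] (G : SimpleGraph V) :
    flood G (Fintype.card V) ≤ (1 : ℕ) := by
  refine (flood_le_iff G _ 1).2 ⟨Finset.univ, Finset.card_univ, ?_⟩
  exact (floodTime_le_succ_iff G _ 0).2 fun v _ => by simp [reach]

theorem flood_le_two_of_two_thirds [Fintype V] {G : SimpleGraph V} (hG : G.Connected) {k : ℕ}
    (hkn : k ≤ Fintype.card V) (hk : 2 * Fintype.card V ≤ 3 * k) : flood G k ≤ (2 : ℕ) := by
  by_cases hn : 3 ≤ Fintype.card V
  · obtain ⟨S, hS, hcard⟩ := exists_isTotalDominating_of_connected hG hn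
    exact flood_le_two_of_isTotalDominating hS (by omega) hkn
  -- For `n ≤ 2`, the bound `k ≥ 2n/3` rounds up to `k = n`.
  · obtain rfl : k = Fintype.card V := by omega
    exact (flood_card_le_one G).trans (by norm_num)

theorem flood_le_two_of_three_le_minDegree [Fintype V] (G : SimpleGraph V) [DecidableRel G.Adj]
    {k : ℕ} (hkn : k ≤ Fintype.card V) (hG : 3 ≤ G.minDegree) (hk : Fintype.card V ≤ 2 * k) :
    flood G k ≤ (2 : ℕ) := by
  obtain ⟨S, hS, hcard⟩ := exists_isTotalDominating_of_three_le_minDegree G hG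
  exact flood_le_two_of_isTotalDominating hS (by omega) hkn

/-- In a connected graph, a vertex without a companion at walk-distance two is the centre of a
spanning star. -/
theorem adj_of_no_common_neighbor {G : SimpleGraph V} (hG : G.Connected) {c : V}
    (hc : ∀ w, w ≠ c → ∀ u, G.Adj c u → ¬ G.Adj u w) {v : V} (hv : v ≠ c) : G.Adj c v := by
  by_contra hcv
  have hne : {v | v = c ∨ G.Adj c v} ≠ Set.univ := by
    intro h
    have : v ∈ {v | v = c ∨ G.Adj c v} := h ▸ Set.mem_univ v
    exact this.elim hv hcv
  obtain ⟨u, hu, x, hx, hux⟩ := exists_adj_notMem hG ⟨c, Or.inl rfl⟩ hne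
  have hxc : x ≠ c := fun h => hx (Or.inl h)
  rcases hu with rfl | hu
  · exact hx (Or.inr hux)
  · exact hc x hxc u hu hux

/-- The centre alone floods in one round; for `k ≥ 2` the centre and any other node totally
dominate. -/
theorem flood_le_two_of_star [Fintype V] {G : SimpleGraph V} {c : V}
    (hc : ∀ w, w ≠ c → ∀ u, G.Adj c u → ¬ G.Adj u w) (hstar : ∀ v, v ≠ c → G.Adj c v)
    {k : ℕ} (hk : 1 ≤ k) (hkn : k ≤ Fintype.card V) : flood G k ≤ (2 : ℕ) := by
  classical
  by_cases hk1 : k = 1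
  · refine (flood_le_iff G k 2).2 ⟨{c}, by simp [hk1], ?_⟩
    refine le_trans ((floodTime_le_succ_iff G _ 0).2 ?_) (by norm_num : ((0 + 1 : ℕ) : ℕ∞) ≤ _)
    rintro v ⟨u, ⟨s, hs, hsu⟩, huv⟩
    obtain rfl : s = c := by simpa [reach] using hs
    by_contra hv
    exact hc v (by simpa [reach] using hv) u hsu huv
  · have : Nontrivial V := Fintype.one_lt_card_iff_nontrivial.1 (by omega)
    obtain ⟨d, hd⟩ := exists_ne c
    refine flood_le_two_of_isTotalDominating (S := {c, d}) (fun v => ?_)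
      (Finset.card_le_two.trans (by omega)) hkn
    by_cases hv : v = c
    · exact ⟨d, by simp, hv ▸ hstar d hd⟩
    · exact ⟨c, by simp, (hstar v hv).symm⟩

theorem flood_le_three_of_half [Fintype V] {G : SimpleGraph V} (hG : G.Connected) {k : ℕ}
    (hk : 1 ≤ k) (hkn : k ≤ Fintype.card V) (hhalf : Fintype.card V ≤ 2 * k) :
    flood G k ≤ (3 : ℕ) := by
  by_cases hstar : ∃ c, ∀ w, w ≠ c → ∀ u, G.Adj c u → ¬ G.Adj u w
  · obtain ⟨c, hc⟩ := hstar
    exact (flood_le_two_of_star hc (fun v hv => adj_of_no_common_neighbor hG hc hv) hk hkn).trans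
      (by norm_num)
  push Not at hstar
  obtain ⟨S, hS, hcard⟩ := exists_dominating_of_symm
    (r := fun v w => ∃ u, G.Adj v u ∧ G.Adj u w)
    (fun v w ⟨u, h1, h2⟩ => ⟨u, h2.symm, h1.symm⟩) hstar
  obtain ⟨T, hST, hT⟩ := Finset.exists_superset_card_eq (by omega : S.card ≤ k) hkn
  refine (flood_le_iff G k 3).2 ⟨T, hT, (floodTime_le_succ_iff G _ 2).2 fun v _ => ?_⟩
  by_cases hv : v ∈ T
  -- Nodes of `T` return to themselves by going to a neighbour and back.
  · obtain ⟨-, -, u, hu, -⟩ := hstar v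
    exact ⟨u, ⟨v, hv, hu⟩, hu.symm⟩
  · obtain ⟨w, hw, u, hvu, huw⟩ := hS v fun h => hv (hST h)
    exact ⟨u, ⟨w, hST hw, huw.symm⟩, hvu.symm⟩

end AmnesiacFlooding

theorem theorem2 {V : Type*} [Fintype V] (G : SimpleGraph V) [DecidableRel G.Adj]
    (hG : G.Connected) (k : ℕ) (hk : 1 ≤ k) (hkn : k ≤ Fintype.card V) :
    -- (1)
    (1 < k →
      AmnesiacFlooding.kRadius G k ≤ AmnesiacFlooding.flood G k ∧
      AmnesiacFlooding.flood G k ≤ AmnesiacFlooding.niRadius G k + 1 ∧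
      AmnesiacFlooding.niRadius G k + 1 ≤ AmnesiacFlooding.kRadius G (k / 2) + 1) ∧
    -- (2)
    (2 ≤ Fintype.card V →
      (AmnesiacFlooding.flood G k = 1 ↔
        Fintype.card V = k ∨
        ∃ V₁ V₂ : Finset V, G.IsBipartiteWith (V₁ : Set V) (V₂ : Set V) ∧
          (V₁ : Set V) ∪ (V₂ : Set V) = Set.univ ∧ (V₁.card = k ∨ V₂.card = k))) ∧
    -- (3)
    ((2 * Fintype.card V ≤ 3 * k ∨ (3 ≤ G.minDegree ∧ Fintype.card V ≤ 2 * k)) →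
      AmnesiacFlooding.flood G k ≤ 2) ∧
    -- (4)
    (Fintype.card V ≤ 2 * k → AmnesiacFlooding.flood G k ≤ 3) := by
  refine ⟨fun hk1 => ⟨AmnesiacFlooding.kRadius_le_flood hG hk,
    AmnesiacFlooding.flood_le_niRadius_add_one G k, ?_⟩,
    fun hn => AmnesiacFlooding.flood_eq_one_iff hG hn hk, ?_,
    AmnesiacFlooding.flood_le_three_of_half hG hk hkn⟩
  · gcongr
    exact AmnesiacFlooding.niRadius_le_kRadius_half hG hk1 hkn
  · rintro (h | ⟨hδ, h⟩)
    · exact AmnesiacFlooding.flood_le_two_of_two_thirds hG hkn h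
    · exact AmnesiacFlooding.flood_le_two_of_three_le_minDegree G hkn hδ h
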